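/- Let $\mathcal H\subset\mathbb R$ be open with $(-a_0,a_0)\subset\mathcal H\subset(-a,a)$ for some $0<a_0<a<\infty$. Let $J\in C^2_{\rm c}(\mathbb R)$ satisfy $J\ge 0$, $\{J\neq 0\}=(-d,d)$, $\int_{\mathbb R}J=1$, $J(-x)=J(x)$ for all $x$, and $J(x_1)\ge J(x_2)$ whenever $0\le x_1\le x_2$; put $Lg=J*g-g$. Let $b^+,b^-\ge 0$, and let $\phi:\mathbb R\to\mathbb R$ be a (locally integrable) solution of $$L\phi=0\ \text{ in }\mathbb R\setminus\mathcal H,\qquad \phi=0\ \text{ in }\mathcal H,\qquad \sup_{x\in\mathbb R}\bigl|\phi(x)-\max\{b^+x,-b^-x\}\bigr|<\infty .$$ Let $\psi(x)=\phi(x)-\max\{b^+x,-b^-x\}$. Then $\psi$ is of class $C^2$ on $\mathbb R\setminus\mathcal H$ and there is a constant $C>0$ such that $$|\psi'(x)|\le\frac{C}{|x|^{4/5}},\qquad |\psi''(x)|\le\frac{C}{|x|^{5/3}},\qquad x\in\mathbb R\setminus\mathcal H .$$ Here, since $\mathbb R\setminus\mathcal H$ is closed (and $\psi$ may jump across its boundary),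 the assertion means: there is $\Psi\in C^2(\mathbb R)$ with $\Psi=\psi$ on $\mathbb R\setminus\mathcal H$ such that the bounds hold for $\Psi'$ and $\Psi''$ at every point of $\mathbb R\setminus\mathcal H$; and at interior points of $\mathbb R\setminus\mathcal H$ the function $\psi$ itself is $C^2$ and the bounds hold, with the same $C$, for its ordinary derivatives. -/

import Mathlib

namespace NonlocalHole

/-- The hole: an open set `H` with `(-a₀, a₀) ⊆ H ⊆ (-a, a)` and `0 < a₀ < a`. -/
structure IsHole (H : Set ℝ) (a₀ a : ℝ) : Prop where
  isOpen : IsOpen H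
  a₀_pos : 0 < a₀
  a₀_lt_a : a₀ < a
  Ioo_subset : Set.Ioo (-a₀) a₀ ⊆ H
  subset_Ioo : H ⊆ Set.Ioo (-a) a

/-- The convolution kernel: `J ∈ C²_c(ℝ)` is nonnegative, is nonzero exactly on `(-d, d)`,
has unit integral, is even, and is nonincreasing on `[0, ∞)`. -/
structure IsKernel (J : ℝ → ℝ) (d : ℝ) : Prop where
  contDiff : ContDiff ℝ 2 J
  hasCompactSupport : HasCompactSupport J
  nonneg : ∀ x, 0 ≤ J x
  support_eq : Function.support J = Set.Ioo (-d) d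
  integral_eq_one : ∫ x, J x = 1
  even : ∀ x, J (-x) = J x
  antitone : ∀ x₁ x₂, 0 ≤ x₁ → x₁ ≤ x₂ → J x₂ ≤ J x₁

/-- The nonlocal operator `L g = J * g - g`. -/
noncomputable def nonlocalOp (J g : ℝ → ℝ) (x : ℝ) : ℝ :=
  MeasureTheory.convolution J g (ContinuousLinearMap.mul ℝ ℝ) MeasureTheory.volume x - g x

/-- The profile at infinity `max {b⁺ x, -b⁻ x}`. -/
noncomputable def profile (bp bm : ℝ) (x : ℝ) : ℝ := max (bp * x) (-bm * x)

/-- Solutions of the stationary problem: `L φ = 0` in `ℝ \ H`, `φ = 0` in `H`, and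
`φ - max {b⁺ x, -b⁻ x}` is bounded. Local integrability makes `J * φ` meaningful. -/
structure IsStationary (J : ℝ → ℝ) (H : Set ℝ) (bp bm : ℝ) (φ : ℝ → ℝ) : Prop where
  locallyIntegrable : MeasureTheory.LocallyIntegrable φ MeasureTheory.volume
  eq_outside : ∀ x ∈ Hᶜ, nonlocalOp J φ x = 0
  eq_zero : ∀ x ∈ H, φ x = 0
  bounded : ∃ K : ℝ, ∀ x, |φ x - profile bp bm x| ≤ K

/-- The remainder `ψ(x) = φ(x) - max {b⁺ x, -b⁻ x}`. -/
noncomputable def remainder (bp bm : ℝ) (φ : ℝ → ℝ) (x : ℝ) : ℝ := φ x - profile bp bm x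

end NonlocalHole

/-! Off `H` the equation says `φ = J * φ`, and `J * φ` is `C²` on all of `ℝ`. Subtracting a smoothed
profile therefore gives the extension `Ψ`, and only decay at `±∞` is at stake; compactness covers
the rest.

Since `J` is even with mass 1, it reproduces linear functions. Far to the right the remainder `u` is
thus bounded with `J * u = u`. Let `K` be the even extension of the second primitive of `J`
vanishing at `d`. Formally `(K * u)'' = J * u - u = 0`, so `K * u` is affine there, and bounded,
hence constant (`exists_symAvg_secondPrimitive_eq`). For a suitable constant `c`, `v = u - c`
satisfies `K * v = 0`, so `v = (J - K / d²) * v`. Monotonicity of `J` makes this kernel nonnegative,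
and its mass is below 1, so each step of length `d` shrinks `v` by a fixed factor
(`exists_limit_of_symAvg_eq`).

Writing `u = J * v + c`, derivatives fall on `J` and inherit the decay of `v`
(`IsKernel.exists_deriv_decay`). The rate `x⁻²` beats both required powers; reflection treats `-∞`.
-/

namespace NonlocalHole

open Set Filter Topology MeasureTheory

/-! ### Symmetric averages -/

/-- The symmetric weighted sum `∫₀ᵈ k(y) (u(x+y) + u(x-y)) dy`, i.e. the convolution of `u` with
the even extension of `k` from `[0, d]`. -/
noncomputable def symAvg (k : ℝ → ℝ) (d : ℝ) (u : ℝ → ℝ) (x : ℝ) : ℝ :=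
  ∫ y in (0 : ℝ)..d, k y * (u (x + y) + u (x - y))

theorem hasDerivAt_symAvg {k f f' : ℝ → ℝ} {d : ℝ} (hk : Continuous k) (hf' : Continuous f')
    (hff' : ∀ x, HasDerivAt f (f' x) x) (x : ℝ) :
    HasDerivAt (symAvg k d f) (symAvg k d f' x) x := by
  have hf : Continuous f := continuous_iff_continuousAt.2 fun x => (hff' x).continuousAt
  have hc : Continuous fun p : ℝ × ℝ => k p.2 * (f' (p.1 + p.2) + f' (p.1 - p.2)) := by fun_prop
  obtain ⟨M, hM⟩ := ((isCompact_closedBall x 1).prod (isCompact_uIcc (a := 0) (b := d))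
    ).exists_bound_of_continuousOn hc.continuousOn
  refine (intervalIntegral.hasDerivAt_integral_of_dominated_loc_of_deriv_le
    (F := fun x y => k y * (f (x + y) + f (x - y)))
    (F' := fun x y => k y * (f' (x + y) + f' (x - y))) (bound := fun _ => M)
    (Metric.closedBall_mem_nhds x one_pos) ?_ ?_ ?_ ?_ ?_ ?_).2
  · exact Eventually.of_forall fun z => (by fun_prop : Continuous _).aestronglyMeasurable
  · exact (by fun_prop : Continuous _).intervalIntegrable _ _
  · exact (by fun_prop : Continuous _).aestronglyMeasurable
  · exact ae_of_all _ fun t ht z hz => hM (z, t) ⟨hz, uIoc_subset_uIcc ht⟩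
  · exact intervalIntegrable_const
  · refine ae_of_all _ fun t _ z _ => ?_
    exact (((hff' (z + t)).comp_add_const z t).add ((hff' (z - t)).comp_sub_const z t)).const_mul _

theorem symAvg_sub_const {k u : ℝ → ℝ} (d : ℝ) (hk : Continuous k) (hu : Continuous u) (c x : ℝ) :
    symAvg k d (fun y => u y - c) x = symAvg k d u x - 2 * c * ∫ y in (0 : ℝ)..d, k y := by
  unfold symAvg
  rw [← intervalIntegral.integral_const_mul, ← intervalIntegral.integral_sub]
  · congr 1; ext y; ring
  · exact (by fun_prop : Continuous _).intervalIntegrable _ _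
  · exact (by fun_prop : Continuous _).intervalIntegrable _ _

theorem abs_symAvg_le {k u : ℝ → ℝ} {d : ℝ} (hd : 0 ≤ d) (hk : Continuous k)
    (hk0 : ∀ y ∈ Icc 0 d, 0 ≤ k y) {x B : ℝ}
    (hB : ∀ z, |z - x| ≤ d → |u z| ≤ B) :
    |symAvg k d u x| ≤ 2 * (∫ y in (0 : ℝ)..d, k y) * B := by
  have : 2 * (∫ y in (0 : ℝ)..d, k y) * B = ∫ y in (0 : ℝ)..d, k y * (2 * B) := by
    rw [intervalIntegral.integral_mul_const]; ring
  rw [this, ← Real.norm_eq_abs]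
  refine intervalIntegral.norm_integral_le_of_norm_le hd (ae_of_all _ fun y hy => ?_)
    ((by fun_prop : Continuous _).intervalIntegrable _ _)
  have hy' : y ∈ Icc 0 d := ⟨hy.1.le, hy.2⟩
  rw [norm_mul, Real.norm_eq_abs, abs_of_nonneg (hk0 y hy'), Real.norm_eq_abs]
  refine mul_le_mul_of_nonneg_left ((abs_add_le _ _).trans ?_) (hk0 y hy')
  have h1 := hB (x + y) (by simpa [abs_of_nonneg hy'.1] using hy'.2)
  have h2 := hB (x - y) (by simpa [abs_of_nonneg hy'.1] using hy'.2)
  linarith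

/-! ### The second primitive of the kernel -/

/-- The second primitive of `k` that vanishes to second order at `d`. -/
noncomputable def secondPrimitive (k : ℝ → ℝ) (d s : ℝ) : ℝ := ∫ t in d..s, ∫ r in d..t, k r

section SecondPrimitive

variable {k : ℝ → ℝ} {d : ℝ}

theorem continuous_primitive_of_continuous (hk : Continuous k) (b : ℝ) :
    Continuous fun t => ∫ r in b..t, k r :=
  intervalIntegral.continuous_primitive (fun _ _ => hk.intervalIntegrable _ _) b

theorem hasDerivAt_primitive (hk : Continuous k) (b t : ℝ) :
    HasDerivAt (fun t => ∫ r in b..t, k r) (k t) t :=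
  intervalIntegral.integral_hasDerivAt_right (hk.intervalIntegrable _ _)
    (hk.stronglyMeasurableAtFilter _ _) hk.continuousAt

theorem continuous_secondPrimitive (hk : Continuous k) : Continuous (secondPrimitive k d) :=
  continuous_primitive_of_continuous (continuous_primitive_of_continuous hk d) d

theorem secondPrimitive_pos (hk : Continuous k) (hpos : ∀ y ∈ Ioo 0 d, 0 < k y) {s : ℝ}
    (hs : s ∈ Ioo 0 d) : 0 < secondPrimitive k d s := by
  have hc := continuous_primitive_of_continuous hk d
  rw [secondPrimitive, intervalIntegral.integral_symm, ← intervalIntegral.integral_neg]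
  refine intervalIntegral.intervalIntegral_pos_of_pos_on (hc.neg.intervalIntegrable _ _)
    (fun t ht => ?_) hs.2
  rw [intervalIntegral.integral_symm, neg_neg]
  exact intervalIntegral.intervalIntegral_pos_of_pos_on (hk.intervalIntegrable _ _)
    (fun r hr => hpos r ⟨hs.1.trans (ht.1.trans hr.1), hr.2⟩) ht.2

/-- Each of the two integrations runs over a length at most `d`, and the integrand never exceeds `k
s`. This is where monotonicity of the kernel enters; it makes `k - secondPrimitive k d / d ^ 2`
nonnegative. -/
theorem secondPrimitive_le (hk : Continuous k) (hk0 : ∀ y ∈ Icc 0 d, 0 ≤ k y)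
    (hanti : ∀ x₁ x₂, 0 ≤ x₁ → x₁ ≤ x₂ → k x₂ ≤ k x₁) {s : ℝ} (hs : s ∈ Icc 0 d) :
    secondPrimitive k d s ≤ d ^ 2 * k s := by
  have hc := continuous_primitive_of_continuous hk d
  have hks := hk0 s hs
  have hd : 0 ≤ d := hs.1.trans hs.2
  have inner : ∀ t ∈ Icc s d, (-∫ r in d..t, k r) ≤ d * k s := fun t ht => by
    rw [intervalIntegral.integral_symm, neg_neg]
    calc ∫ r in t..d, k r ≤ ∫ _ in t..d, k s :=
          intervalIntegral.integral_mono_on ht.2 (hk.intervalIntegrable _ _)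
            intervalIntegrable_const fun r hr => hanti s r hs.1 (ht.1.trans hr.1)
      _ = (d - t) * k s := by simp
      _ ≤ d * k s := by
          refine mul_le_mul_of_nonneg_right ?_ hks
          linarith [hs.1, ht.1]
  rw [secondPrimitive, intervalIntegral.integral_symm, ← intervalIntegral.integral_neg]
  calc ∫ t in s..d, -∫ r in d..t, k r ≤ ∫ _ in s..d, d * k s :=
        intervalIntegral.integral_mono_on hs.2 (hc.neg.intervalIntegrable _ _)
          intervalIntegrable_const inner
    _ = (d - s) * (d * k s) := by simp; ring
    _ ≤ d * (d * k s) := by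
        refine mul_le_mul_of_nonneg_right ?_ (by positivity)
        linarith [hs.1]
    _ = d ^ 2 * k s := by ring

/-- Two integrations by parts. -/
theorem symAvg_secondPrimitive (hk : Continuous k) {u f F : ℝ → ℝ} (hu : Continuous u)
    (hf : ∀ x, HasDerivAt f (u x) x) (hF : ∀ x, HasDerivAt F (f x) x) (x : ℝ) :
    symAvg (secondPrimitive k d) d u x =
      symAvg k d F x - 2 * (∫ y in (0 : ℝ)..d, k y) * F x := by
  have hfc : Continuous f := continuous_iff_continuousAt.2 fun x => (hf x).continuousAt
  have hFc : Continuous F := continuous_iff_continuousAt.2 fun x => (hF x).continuousAt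
  have hc := continuous_primitive_of_continuous hk d
  have hK : Continuous (secondPrimitive k d) := continuous_secondPrimitive hk
  -- All boundary terms of this antiderivative vanish: at `y = d` through the two primitives of `k`,
  -- at `y = 0` through the two differences.
  have hder : ∀ y, HasDerivAt
      (fun y => secondPrimitive k d y * (f (x + y) - f (x - y)) -
        (∫ r in d..y, k r) * (F (x + y) + F (x - y) - 2 * F x))
      (secondPrimitive k d y * (u (x + y) + u (x - y)) -
        k y * (F (x + y) + F (x - y) - 2 * F x)) y := fun y => by
    have h1 := ((hf (x + y)).comp_const_add x y).sub ((hf (x - y)).comp_const_sub x y)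
    have h2 := (((hF (x + y)).comp_const_add x y).add ((hF (x - y)).comp_const_sub x y)).sub_const
      (2 * F x)
    have h3 : HasDerivAt (secondPrimitive k d) (∫ r in d..y, k r) y := hasDerivAt_primitive hc d y
    refine ((h3.mul h1).sub ((hasDerivAt_primitive hk d y).mul h2)).congr_deriv ?_
    simp only [Pi.sub_apply, Pi.add_apply]
    ring
  have := intervalIntegral.integral_eq_sub_of_hasDerivAt (a := 0) (b := d) (fun y _ => hder y)
    ((by fun_prop : Continuous _).intervalIntegrable _ _)
  rw [intervalIntegral.integral_sub ((by fun_prop : Continuous _).intervalIntegrable _ _)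
    ((by fun_prop : Continuous _).intervalIntegrable _ _)] at this
  have h0 : secondPrimitive k d d = 0 := by simp [secondPrimitive]
  have h4 : ∫ y in (0 : ℝ)..d, k y * (F (x + y) + F (x - y) - 2 * F x) =
      symAvg k d F x - 2 * (∫ y in (0 : ℝ)..d, k y) * F x := by
    rw [symAvg, mul_right_comm, ← intervalIntegral.integral_const_mul,
      ← intervalIntegral.integral_sub ((by fun_prop : Continuous _).intervalIntegrable _ _)
      ((by fun_prop : Continuous _).intervalIntegrable _ _)]
    congr 1; ext y; ring
  rw [h4] at this
  simp only [h0, intervalIntegral.integral_same, add_zero, sub_zero, sub_self, mul_zero] at this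
  rw [symAvg]
  linarith

end SecondPrimitive

/-! ### Convergence of bounded solutions on a half-line -/

theorem exists_eq_of_deriv_eq_zero_Ioi {f f' : ℝ → ℝ} {R : ℝ}
    (hf : ∀ x, HasDerivAt f (f' x) x) (h0 : ∀ x, R < x → f' x = 0) :
    ∃ c, ∀ x, R < x → f x = c :=
  ⟨f (R + 1), fun x hx => isOpen_Ioi.is_const_of_deriv_eq_zero (convex_Ioi R).isPreconnected
    (fun y _ => (hf y).differentiableAt.differentiableWithinAt)
    (fun y hy => (hf y).deriv.trans (h0 y hy)) hx (by simp)⟩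

/-- A bounded solution on a half-line has constant average against the second primitive. -/
theorem exists_symAvg_secondPrimitive_eq {k u : ℝ → ℝ} {d M R : ℝ} (hd : 0 < d)
    (hk : Continuous k) (hpos : ∀ y ∈ Ioo 0 d, 0 < k y) (hu : Continuous u)
    (hM : ∀ x, |u x| ≤ M)
    (hmass : ∫ y in (0 : ℝ)..d, k y = 1 / 2) (heq : ∀ x, R < x → symAvg k d u x = u x) :
    ∃ c, ∀ x, R < x → symAvg (secondPrimitive k d) d u x = c := by
  set f : ℝ → ℝ := fun x => ∫ t in (0 : ℝ)..x, u t
  have hf : ∀ x, HasDerivAt f (u x) x := hasDerivAt_primitive hu 0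
  have hfc : Continuous f := continuous_primitive_of_continuous hu 0
  have hF : ∀ x, HasDerivAt (fun x => ∫ t in (0 : ℝ)..x, f t) (f x) x := hasDerivAt_primitive hfc 0
  obtain ⟨p, hp⟩ := exists_eq_of_deriv_eq_zero_Ioi (R := R)
    (fun x => (hasDerivAt_symAvg (d := d) hk hu hf x).sub (hf x))
    (fun x hx => by simp [heq x hx])
  have hW : ∀ x, symAvg (secondPrimitive k d) d u x =
      symAvg k d (fun x => ∫ t in (0 : ℝ)..x, f t) x - ∫ t in (0 : ℝ)..x, f t := fun x => by
    rw [symAvg_secondPrimitive hk hu hf hF, hmass]; ring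
  obtain ⟨q, hq⟩ := exists_eq_of_deriv_eq_zero_Ioi (R := R)
    (fun x => ((hasDerivAt_symAvg (d := d) hk hfc hF x).sub (hF x)).sub
      ((hasDerivAt_id x).const_mul p))
    (fun x hx => by have := hp x hx; simp only [Pi.sub_apply] at this; linarith)
  simp only [Pi.sub_apply, ← hW] at hq
  have hK : Continuous (secondPrimitive k d) := continuous_secondPrimitive hk
  have hK0 : ∀ y ∈ Icc 0 d, 0 ≤ secondPrimitive k d y := by
    have := closure_minimal (s := Ioo 0 d) (t := {y | 0 ≤ secondPrimitive k d y})
      (fun y hy => (secondPrimitive_pos hk hpos hy).le) (isClosed_le continuous_const hK)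
    rwa [closure_Ioo hd.ne] at this
  have hB := fun x => abs_symAvg_le hd.le hK hK0 (x := x) (fun z _ => hM z)
  set B := 2 * (∫ y in (0 : ℝ)..d, secondPrimitive k d y) * M
  -- `hq` makes the average affine with slope `p`, while `hB` bounds it by `B`. The point `x` below
  -- is far enough out that `|p| * x` exceeds `B + |q|`.
  have hp0 : p = 0 := by
    by_contra hne
    have hp' : 0 < |p| := abs_pos.2 hne
    set x := |R| + 1 + (B + |q|) / |p|
    have hB0 : 0 ≤ B := (abs_nonneg _).trans (hB 0)
    have hx0 : |R| + 1 ≤ x := le_add_of_nonneg_right (by positivity)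
    have hx : R < x := by linarith [le_abs_self R]
    have h1 := hq x hx
    have h2 : |p * x| ≤ B + |q| := by
      have : p * x = symAvg (secondPrimitive k d) d u x - q := by
        simp only [id] at h1; linarith
      rw [this]
      exact (abs_sub _ _).trans (by linarith [hB x])
    rw [abs_mul, abs_of_pos (a := x) (by linarith [abs_nonneg R])] at h2
    have h3 : |p| * x = |p| * (|R| + 1) + (B + |q|) := by
      simp only [x]; field_simp
    nlinarith [abs_nonneg R]
  exact ⟨q, fun x hx => by simpa [hp0] using hq x hx⟩

/-- Contraction at each step of length `d` yields decay faster than `x⁻²`. -/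
theorem exists_le_div_sq_of_contraction {v : ℝ → ℝ} {d θ B R : ℝ} (hd : 0 < d) (hθ0 : 0 ≤ θ)
    (hθ1 : θ < 1) (hB : ∀ x, |v x| ≤ B)
    (hstep : ∀ x, R < x → ∀ b, (∀ z, |z - x| ≤ d → |v z| ≤ b) → |v x| ≤ θ * b) :
    ∃ A R', 1 ≤ R' ∧ ∀ x, R' < x → |v x| ≤ A / x ^ 2 := by
  have hiter : ∀ n : ℕ, ∀ x, R + n * d < x → |v x| ≤ θ ^ n * B := by
    intro n
    induction n with
    | zero => intro x _; simpa using hB x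
    | succ n ih =>
      intro x hx
      push_cast at hx
      have hn : 0 ≤ n * d := by positivity
      rw [pow_succ', mul_assoc]
      exact hstep x (by linarith) _ fun z hz => ih z (by linarith [(abs_le.1 hz).1])
  have hB0 : 0 ≤ B := (abs_nonneg _).trans (hB 0)
  -- The geometric rate is traded for `n⁻²`, where `n` is comparable to `x`.
  obtain ⟨D, hD⟩ := (tendsto_pow_const_mul_const_pow_of_lt_one 2 hθ0 hθ1).bddAbove_range
  have hD' : ∀ n : ℕ, (n : ℝ) ^ 2 * θ ^ n ≤ D := fun n => hD ⟨n, rfl⟩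
  set R' := |R| + d + 1
  refine ⟨D * B * (R' + d) ^ 2, R', by simp only [R']; linarith [abs_nonneg R], fun x hx => ?_⟩
  have hR' : 0 < R' := by positivity
  have hx0 : 0 < x := hR'.trans hx
  have hxR : d < x - |R| := by simp only [R'] at hx; linarith
  obtain ⟨n, hn1, hn2⟩ : ∃ n : ℕ, n * d < x - |R| ∧ x - |R| ≤ (n + 1) * d := by
    -- Ceiling minus one rather than floor: `hiter` needs the strict inequality `n * d < x - |R|`.
    refine ⟨⌈(x - |R|) / d⌉₊ - 1, ?_, ?_⟩
    all_goals
      have h1 : 1 ≤ ⌈(x - |R|) / d⌉₊ := Nat.one_le_ceil_iff.2 (div_pos (hd.trans hxR) hd)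
      rw [Nat.cast_sub h1, Nat.cast_one]
    · rw [← lt_div_iff₀ hd]
      linarith [Nat.ceil_lt_add_one (div_pos (hd.trans hxR) hd).le]
    · rw [← div_le_iff₀ hd, sub_add_cancel]
      exact Nat.le_ceil _
  have hn : 1 ≤ n := by
    by_contra h
    have : n = 0 := by omega
    subst this
    simp at hn2
    linarith
  have hn' : (1 : ℝ) ≤ n := by exact_mod_cast hn
  have hxn : x ≤ (R' + d) * n := by
    have : |R| ≤ |R| * n := le_mul_of_one_le_right (abs_nonneg R) hn'
    have : d ≤ d * n := le_mul_of_one_le_right hd.le hn'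
    simp only [R']
    nlinarith
  have hv := hiter n x (by linarith [le_abs_self R])
  rw [le_div_iff₀ (by positivity)]
  calc |v x| * x ^ 2 ≤ (θ ^ n * B) * ((R' + d) * n) ^ 2 := by gcongr
    _ = (n ^ 2 * θ ^ n) * (B * (R' + d) ^ 2) := by ring
    _ ≤ D * (B * (R' + d) ^ 2) := by gcongr; exact hD' n
    _ = _ := by ring

/-- Bounded solutions of the nonlocal equation on a half-line converge at infinity,
faster than `x⁻²`. -/
theorem exists_limit_of_symAvg_eq {k u : ℝ → ℝ} {d M R : ℝ} (hd : 0 < d)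
    (hk : Continuous k) (hpos : ∀ y ∈ Ioo 0 d, 0 < k y)
    (hanti : ∀ x₁ x₂, 0 ≤ x₁ → x₁ ≤ x₂ → k x₂ ≤ k x₁) (hu : Continuous u)
    (hM : ∀ x, |u x| ≤ M)
    (hmass : ∫ y in (0 : ℝ)..d, k y = 1 / 2) (heq : ∀ x, R < x → symAvg k d u x = u x) :
    ∃ c A R', 1 ≤ R' ∧ ∀ x, R' < x → |u x - c| ≤ A / x ^ 2 := by
  have hK : Continuous (secondPrimitive k d) := continuous_secondPrimitive hk
  have hk0 : ∀ y ∈ Icc 0 d, 0 ≤ k y := by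
    have := closure_minimal (s := Ioo 0 d) (t := {y | 0 ≤ k y})
      (fun y hy => (hpos y hy).le) (isClosed_le continuous_const hk)
    rwa [closure_Ioo hd.ne] at this
  set κ := ∫ y in (0 : ℝ)..d, secondPrimitive k d y
  have hκ : 0 < κ := intervalIntegral.intervalIntegral_pos_of_pos_on (hK.intervalIntegrable _ _)
    (fun y hy => secondPrimitive_pos hk hpos hy) hd
  obtain ⟨e, he⟩ := exists_symAvg_secondPrimitive_eq hd hk hpos hu hM hmass heq
  -- The constant whose average against the second primitive is `e`, so that of `u - c` vanishes.
  set c := e / (2 * κ)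
  set v : ℝ → ℝ := fun y => u y - c
  have hv : Continuous v := by fun_prop
  set G : ℝ → ℝ := fun y => k y - secondPrimitive k d y / d ^ 2
  have hG : Continuous G := by fun_prop
  have hG0 : ∀ y ∈ Icc 0 d, 0 ≤ G y := fun y hy => by
    simp only [G, sub_nonneg]
    rw [div_le_iff₀ (by positivity), mul_comm]
    exact secondPrimitive_le hk hk0 hanti hy
  have hGint : ∫ y in (0 : ℝ)..d, G y = 1 / 2 - κ / d ^ 2 := by
    simp only [G]
    rw [intervalIntegral.integral_sub (hk.intervalIntegrable _ _)
      ((by fun_prop : Continuous _).intervalIntegrable _ _), hmass,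
      intervalIntegral.integral_div]
  have hvG : ∀ x, R < x → v x = symAvg G d v x := fun x hx => by
    have h1 : symAvg k d v x = v x := by
      rw [symAvg_sub_const d hk hu, hmass, heq x hx]; simp only [v]; ring
    have h2 : symAvg (secondPrimitive k d) d v x = 0 := by
      rw [symAvg_sub_const d hK hu, he x hx]
      change e - 2 * (e / (2 * κ)) * κ = 0
      field_simp
      ring
    have h3 : symAvg G d v x =
        symAvg k d v x - symAvg (secondPrimitive k d) d v x / d ^ 2 := by
      unfold symAvg
      rw [← intervalIntegral.integral_div, ← intervalIntegral.integral_sub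
        ((by fun_prop : Continuous _).intervalIntegrable _ _)
        ((by fun_prop : Continuous _).intervalIntegrable _ _)]
      congr 1; ext y; simp only [G]; ring
    rw [h3, h1, h2]; simp
  have hθ : 2 * ∫ y in (0 : ℝ)..d, G y < 1 := by
    rw [hGint]
    have : 0 < κ / d ^ 2 := by positivity
    linarith
  have hθ0 : 0 ≤ 2 * ∫ y in (0 : ℝ)..d, G y :=
    mul_nonneg zero_le_two (intervalIntegral.integral_nonneg hd.le hG0)
  obtain ⟨A, R', hR', h⟩ := exists_le_div_sq_of_contraction (v := v) (B := M + |c|) (R := R)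
    hd hθ0 hθ (fun x => (abs_sub _ _).trans (by linarith [hM x]))
    (fun x hx b hb => by
      rw [hvG x hx]
      exact abs_symAvg_le hd.le hG hG0 hb)
  exact ⟨c, A, R', hR', h⟩

/-! ### Convolution with the kernel and decay of derivatives -/

theorem abs_convolution_le {g v : ℝ → ℝ} {d x B : ℝ} (hg : Continuous g)
    (hgc : HasCompactSupport g) (hsupp : ∀ t, d < |t| → g t = 0)
    (hB : ∀ z, |z - x| ≤ d → |v z| ≤ B) :
    |convolution g v (ContinuousLinearMap.mul ℝ ℝ) volume x| ≤ (∫ t, |g t|) * B := by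
  rw [convolution, ← integral_mul_const, ← Real.norm_eq_abs]
  refine norm_integral_le_of_norm_le
    ((hg.integrable_of_hasCompactSupport hgc).abs.mul_const B) (ae_of_all _ fun t => ?_)
  rw [ContinuousLinearMap.mul_apply', norm_mul, Real.norm_eq_abs, Real.norm_eq_abs]
  by_cases ht : d < |t|
  · simp [hsupp t ht]
  · exact mul_le_mul_of_nonneg_left (hB _ (by simpa using ht)) (abs_nonneg _)

theorem convolution_congr_right {g v w : ℝ → ℝ} {d x : ℝ} (hsupp : ∀ t, d ≤ |t| → g t = 0)
    (hvw : ∀ z, |z - x| < d → v z = w z) :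
    convolution g v (ContinuousLinearMap.mul ℝ ℝ) volume x =
      convolution g w (ContinuousLinearMap.mul ℝ ℝ) volume x := by
  unfold convolution
  congr 1; ext t
  by_cases ht : d ≤ |t|
  · simp [hsupp t ht]
  · simp only [ContinuousLinearMap.mul_apply']
    rw [hvw _ (by simpa using ht)]

/-- Evenness lets the behaviour at `-∞` be read off from that at `+∞`. -/
theorem convolution_comp_neg {g v : ℝ → ℝ} (heven : ∀ t, g (-t) = g t) (x : ℝ) :
    convolution g (fun y => v (-y)) (ContinuousLinearMap.mul ℝ ℝ) volume x =
      convolution g v (ContinuousLinearMap.mul ℝ ℝ) volume (-x) := by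
  unfold convolution
  rw [← integral_neg_eq_self]
  congr 1; ext t
  simp only [ContinuousLinearMap.mul_apply', heven]
  congr 2; ring

namespace IsKernel

variable {J : ℝ → ℝ} {d : ℝ}

theorem eq_zero (hJ : IsKernel J d) {t : ℝ} (ht : d ≤ |t|) : J t = 0 := by
  have : t ∉ Function.support J := by
    rw [hJ.support_eq]
    exact fun h => absurd (abs_lt.2 h) (not_lt.2 ht)
  simpa using this

theorem pos_radius (hJ : IsKernel J d) : 0 < d := by
  by_contra h
  have h0 : J = 0 := by
    ext t
    exact hJ.eq_zero ((not_lt.1 h).trans (abs_nonneg t))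
  have := hJ.integral_eq_one
  simp [h0] at this

theorem continuous (hJ : IsKernel J d) : Continuous J := hJ.contDiff.continuous

theorem pos (hJ : IsKernel J d) {y : ℝ} (hy : y ∈ Ioo (-d) d) : 0 < J y := by
  rw [← hJ.support_eq] at hy
  exact (hJ.nonneg y).lt_of_ne' hy

theorem convolution_eq_symAvg (hJ : IsKernel J d) {u : ℝ → ℝ} (hu : Continuous u) (x : ℝ) :
    convolution J u (ContinuousLinearMap.mul ℝ ℝ) volume x = symAvg J d u x := by
  have hd := hJ.pos_radius
  have hJc := hJ.continuous
  have h1 : convolution J u (ContinuousLinearMap.mul ℝ ℝ) volume x =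
      ∫ t in (-d)..d, J t * u (x - t) := by
    rw [intervalIntegral.integral_of_le (by linarith), convolution,
      ← setIntegral_eq_integral_of_forall_compl_eq_zero (s := Ioc (-d) d)]
    · rfl
    · intro t ht
      have : J t = 0 := hJ.eq_zero (by
        by_contra h
        exact ht ⟨(abs_lt.1 (not_le.1 h)).1, (abs_lt.1 (not_le.1 h)).2.le⟩)
      simp [this]
  have hi : ∀ a b, IntervalIntegrable (fun t => J t * u (x - t)) volume a b := fun a b =>
    (by fun_prop : Continuous _).intervalIntegrable _ _
  have hi' : ∀ a b, IntervalIntegrable (fun t => J t * u (x + t)) volume a b := fun a b =>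
    (by fun_prop : Continuous _).intervalIntegrable _ _
  have h2 : ∫ t in (-d)..0, J t * u (x - t) = ∫ t in (0 : ℝ)..d, J t * u (x + t) := by
    have := intervalIntegral.integral_comp_neg (a := 0) (b := d) fun t => J t * u (x - t)
    simp only [hJ.even, sub_neg_eq_add, neg_zero] at this
    exact this.symm
  rw [h1, ← intervalIntegral.integral_add_adjacent_intervals (hi (-d) 0) (hi 0 d), h2,
    ← intervalIntegral.integral_add (hi' _ _) (hi _ _), symAvg]
  congr 1; ext t; ring

theorem integral_half (hJ : IsKernel J d) : ∫ y in (0 : ℝ)..d, J y = 1 / 2 := by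
  have h := hJ.convolution_eq_symAvg (u := fun _ => 1) continuous_const 0
  have h1 : convolution J (fun _ => (1 : ℝ)) (ContinuousLinearMap.mul ℝ ℝ) volume 0 = 1 := by
    simp [convolution, hJ.integral_eq_one]
  rw [h1, symAvg, intervalIntegral.integral_mul_const] at h
  linarith

theorem symAvg_linear (hJ : IsKernel J d) (b x : ℝ) : symAvg J d (fun y => b * y) x = b * x := by
  have : ∀ y, J y * (b * (x + y) + b * (x - y)) = J y * (2 * b * x) := fun y => by ring
  rw [symAvg]
  simp only [this]
  rw [intervalIntegral.integral_mul_const, hJ.integral_half]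
  ring

theorem deriv_eq_zero_of_lt {g : ℝ → ℝ} (hg : ∀ t, d < |t| → g t = 0) {t : ℝ} (ht : d < |t|) :
    deriv g t = 0 := by
  have : g =ᶠ[𝓝 t] fun _ => 0 := by
    filter_upwards [continuous_abs.continuousAt.eventually (lt_mem_nhds ht)] with s hs using hg s hs
  rw [this.deriv_eq, deriv_const]

theorem contDiff_convolution (hJ : IsKernel J d) {φ : ℝ → ℝ} (hφ : LocallyIntegrable φ) :
    ContDiff ℝ 2 (convolution J φ (ContinuousLinearMap.mul ℝ ℝ) volume) := by
  exact_mod_cast hJ.hasCompactSupport.contDiff_convolution_left (n := 2)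
    (ContinuousLinearMap.mul ℝ ℝ) (by exact_mod_cast hJ.contDiff) hφ

/-- Derivative decay at `+∞` for a function that is nonlocally harmonic near `+∞` and at bounded
distance from a linear function there. -/
theorem exists_deriv_decay (hJ : IsKernel J d) {φ : ℝ → ℝ} (hφ : LocallyIntegrable φ)
    {a b M : ℝ}
    (heq : ∀ x, a ≤ x → convolution J φ (ContinuousLinearMap.mul ℝ ℝ) volume x = φ x)
    (hM : ∀ x, a ≤ x → |φ x - b * x| ≤ M) :
    ∃ A R, 1 ≤ R ∧ 0 ≤ A ∧ ∀ x, R < x →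
      |deriv (fun y => convolution J φ (ContinuousLinearMap.mul ℝ ℝ) volume y - b * y) x|
        ≤ A / x ^ 2 ∧
      |deriv (deriv fun y => convolution J φ (ContinuousLinearMap.mul ℝ ℝ) volume y - b * y) x|
        ≤ A / x ^ 2 := by
  have hd := hJ.pos_radius
  set P := convolution J φ (ContinuousLinearMap.mul ℝ ℝ) volume
  have hP : Continuous P := (hJ.contDiff_convolution hφ).continuous
  -- Freezing the argument at `a` makes `u` continuous and bounded on all of `ℝ`, although `φ`
  -- itself may jump near the hole.
  set u : ℝ → ℝ := fun x => P (max x a) - b * max x a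
  have hu : Continuous u := by fun_prop
  have huM : ∀ x, |u x| ≤ M := fun x => by
    simp only [u]
    rw [heq _ (le_max_right _ _)]
    exact hM _ (le_max_right _ _)
  have huP : ∀ x, a ≤ x → u x = P x - b * x := fun x hx => by simp only [u, max_eq_left hx]
  have hueq : ∀ x, a + d < x → symAvg J d u x = u x := fun x hx => by
    have h1 : P x = symAvg J d (fun y => u y + b * y) x := by
      rw [← hJ.convolution_eq_symAvg (by fun_prop)]
      refine convolution_congr_right (fun t => hJ.eq_zero) fun z hz => ?_
      have hz' : a ≤ z := by linarith [(abs_lt.1 hz).1]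
      rw [huP z hz', ← heq z hz']
      ring
    have h2 : symAvg J d (fun y => u y + b * y) x = symAvg J d u x + b * x := by
      rw [← hJ.symAvg_linear b x]
      have hJc := hJ.continuous
      unfold symAvg
      rw [← intervalIntegral.integral_add ((by fun_prop : Continuous _).intervalIntegrable _ _)
        ((by fun_prop : Continuous _).intervalIntegrable _ _)]
      congr 1; ext y; ring
    rw [huP x (by linarith)]
    linarith
  obtain ⟨c, A, R, hR, hdecay⟩ := exists_limit_of_symAvg_eq hd hJ.continuous
    (fun y hy => hJ.pos ⟨by linarith [hy.1], hy.2⟩) hJ.antitone hu huM hJ.integral_half hueq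
  set v : ℝ → ℝ := fun y => u y - c
  have hv : Continuous v := by fun_prop
  -- Beyond `a + d` the averaging window stays in `[a, ∞)`. Having `v` inside the convolution puts
  -- both derivatives on `J`.
  have hnear : ∀ x, a + d < x → P x - b * x =
      convolution J v (ContinuousLinearMap.mul ℝ ℝ) volume x + c := fun x hx => by
    rw [hJ.convolution_eq_symAvg hv, symAvg_sub_const d hJ.continuous hu, hueq x hx,
      hJ.integral_half, huP x (by linarith)]
    ring
  have hJ' : ContDiff ℝ 1 (deriv J) := by
    have : ContDiff ℝ (1 + 1) J := by simpa [one_add_one_eq_two] using hJ.contDiff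
    exact (contDiff_succ_iff_deriv.1 this).2.2
  have hJ1 : ContDiff ℝ 1 J := hJ.contDiff.of_le (by norm_num)
  have hJ'' : Continuous (deriv (deriv J)) := hJ'.continuous_deriv le_rfl
  have hd1 : ∀ x, a + d < x →
      deriv (fun y => P y - b * y) x =
        convolution (deriv J) v (ContinuousLinearMap.mul ℝ ℝ) volume x := fun x hx => by
    have : (fun y => P y - b * y) =ᶠ[𝓝 x] fun y =>
        convolution J v (ContinuousLinearMap.mul ℝ ℝ) volume y + c := by
      filter_upwards [lt_mem_nhds hx] with y hy using hnear y hy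
    rw [this.deriv_eq]
    exact ((hJ.hasCompactSupport.hasDerivAt_convolution_left _ hJ1
      hv.locallyIntegrable x).add_const c).deriv
  have hd2 : ∀ x, a + d < x →
      deriv (deriv fun y => P y - b * y) x =
        convolution (deriv (deriv J)) v (ContinuousLinearMap.mul ℝ ℝ) volume x := fun x hx => by
    have : (deriv fun y => P y - b * y) =ᶠ[𝓝 x]
        convolution (deriv J) v (ContinuousLinearMap.mul ℝ ℝ) volume := by
      filter_upwards [lt_mem_nhds hx] with y hy using hd1 y hy
    rw [this.deriv_eq]
    exact (hJ.hasCompactSupport.deriv.hasDerivAt_convolution_left _ hJ'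
      hv.locallyIntegrable x).deriv
  have hs0 : ∀ t, d < |t| → J t = 0 := fun t ht => hJ.eq_zero ht.le
  have hs1 : ∀ t, d < |t| → deriv J t = 0 := fun t => deriv_eq_zero_of_lt hs0
  have hs2 : ∀ t, d < |t| → deriv (deriv J) t = 0 := fun t => deriv_eq_zero_of_lt hs1
  have hA : 0 ≤ A := by
    have h := (abs_nonneg _).trans (hdecay (R + 1) (by linarith))
    by_contra hneg
    exact absurd h (not_le.2 (div_neg_of_neg_of_pos (not_le.1 hneg) (by positivity)))
  -- As `x > 2 * d`, the window lies in `[x / 2, ∞)`, which costs the factor 4.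
  have hvB : ∀ x, R + |a| + 2 * d < x → ∀ z, |z - x| ≤ d → |v z| ≤ 4 * A / x ^ 2 :=
    fun x hx z hz => by
      have hz1 := (abs_le.1 hz).1
      have hx0 : 0 < x := by linarith [abs_nonneg a]
      have hzx : x / 2 ≤ z := by linarith [abs_nonneg a]
      refine (hdecay z (by linarith [abs_nonneg a])).trans ?_
      calc A / z ^ 2 ≤ A / (x / 2) ^ 2 := by gcongr
        _ = 4 * A / x ^ 2 := by field_simp; ring
  have hI1 : 0 ≤ ∫ t, |deriv J t| := integral_nonneg fun _ => abs_nonneg _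
  have hI2 : 0 ≤ ∫ t, |deriv (deriv J) t| := integral_nonneg fun _ => abs_nonneg _
  refine ⟨((∫ t, |deriv J t|) + ∫ t, |deriv (deriv J) t|) * (4 * A), R + |a| + 2 * d,
    by linarith [abs_nonneg a], by positivity, fun x hx => ?_⟩
  have hx' : a + d < x := by linarith [le_abs_self a]
  have hq : 0 ≤ 4 * A / x ^ 2 := by positivity
  rw [hd1 x hx', hd2 x hx', mul_div_assoc, add_mul]
  constructor
  · exact (abs_convolution_le hJ'.continuous hJ.hasCompactSupport.deriv hs1
      (hvB x hx)).trans (le_add_of_nonneg_right (by positivity))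
  · exact (abs_convolution_le hJ'' hJ.hasCompactSupport.deriv.deriv hs2
      (hvB x hx)).trans (le_add_of_nonneg_left (by positivity))

end IsKernel

/-! ### Joining the two ends -/

theorem _root_.MeasureTheory.LocallyIntegrable.comp_neg_real {φ : ℝ → ℝ}
    (hφ : LocallyIntegrable φ) : LocallyIntegrable fun y => φ (-y) := by
  refine (locallyIntegrable_map_homeomorph (Homeomorph.neg ℝ) (μ := volume)).1 ?_
  rwa [Homeomorph.coe_neg, (Measure.measurePreserving_neg (volume : Measure ℝ)).map_eq]

/-- The smooth function that agrees with the profile outside `(-r, r)`. -/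
noncomputable def smoothProfile (bp bm r x : ℝ) : ℝ :=
  bp * x * Real.smoothTransition (x / r) + -bm * x * Real.smoothTransition (-x / r)

theorem contDiff_smoothProfile (bp bm r : ℝ) : ContDiff ℝ 2 (smoothProfile bp bm r) := by
  have h1 : ContDiff ℝ 2 fun x : ℝ => Real.smoothTransition (x / r) :=
    Real.smoothTransition.contDiff.comp (contDiff_id.div_const r)
  have h2 : ContDiff ℝ 2 fun x : ℝ => Real.smoothTransition (-x / r) :=
    Real.smoothTransition.contDiff.comp (contDiff_neg.div_const r)
  exact ((contDiff_const.mul contDiff_id).mul h1).add ((contDiff_const.mul contDiff_id).mul h2)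

theorem smoothProfile_of_le {bp bm r x : ℝ} (hr : 0 < r) (hx : r ≤ x) :
    smoothProfile bp bm r x = bp * x := by
  have h1 : Real.smoothTransition (x / r) = 1 :=
    Real.smoothTransition.one_of_one_le ((one_le_div hr).2 hx)
  have h2 : Real.smoothTransition (-x / r) = 0 :=
    Real.smoothTransition.zero_of_nonpos (div_nonpos_of_nonpos_of_nonneg (by linarith) hr.le)
  simp [smoothProfile, h1, h2]

theorem smoothProfile_of_le_neg {bp bm r x : ℝ} (hr : 0 < r) (hx : x ≤ -r) :
    smoothProfile bp bm r x = -bm * x := by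
  have h1 : Real.smoothTransition (x / r) = 0 :=
    Real.smoothTransition.zero_of_nonpos (div_nonpos_of_nonpos_of_nonneg (by linarith) hr.le)
  have h2 : Real.smoothTransition (-x / r) = 1 :=
    Real.smoothTransition.one_of_one_le ((one_le_div hr).2 (by linarith))
  simp [smoothProfile, h1, h2]

theorem profile_of_nonneg {bp bm x : ℝ} (hbp : 0 ≤ bp) (hbm : 0 ≤ bm) (hx : 0 ≤ x) :
    profile bp bm x = bp * x :=
  max_eq_left (by nlinarith [mul_nonneg hbp hx, mul_nonneg hbm hx])

theorem profile_of_nonpos {bp bm x : ℝ} (hbp : 0 ≤ bp) (hbm : 0 ≤ bm) (hx : x ≤ 0) :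
    profile bp bm x = -bm * x :=
  max_eq_right (by nlinarith [mul_nonpos_of_nonneg_of_nonpos hbp hx,
    mul_nonpos_of_nonneg_of_nonpos hbm hx])

theorem profile_eq_smoothProfile {bp bm r x : ℝ} (hbp : 0 ≤ bp) (hbm : 0 ≤ bm) (hr : 0 < r)
    (hx : r ≤ |x|) : profile bp bm x = smoothProfile bp bm r x := by
  rcases le_abs'.1 hx with h | h
  · rw [smoothProfile_of_le_neg hr h, profile_of_nonpos hbp hbm (by linarith)]
  · rw [smoothProfile_of_le hr h, profile_of_nonneg hbp hbm (by linarith)]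

theorem IsHole.le_abs_of_notMem {H : Set ℝ} {a₀ a x : ℝ} (hH : IsHole H a₀ a) (hx : x ∉ H) :
    a₀ ≤ |x| := by
  by_contra h
  exact hx (hH.Ioo_subset (abs_lt.1 (not_le.1 h)))

theorem IsHole.notMem_of_le_abs {H : Set ℝ} {a₀ a x : ℝ} (hH : IsHole H a₀ a) (hx : a ≤ |x|) :
    x ∉ H := fun h => absurd (abs_lt.2 (hH.subset_Ioo h)) (not_lt.2 hx)

/-- Quadratic decay at infinity dominates slower power decay away from the origin. -/
theorem le_div_rpow_of_decay {f : ℝ → ℝ} {A R C p : ℝ} (hR : 1 ≤ R) (hp0 : 0 ≤ p) (hp2 : p ≤ 2)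
    (hAC : A ≤ C)
    (hC : ∀ x, |x| ≤ R → |f x| * R ^ 2 ≤ C) (hA : ∀ x, R < |x| → |f x| ≤ A / |x| ^ 2)
    {x : ℝ} (hx : x ≠ 0) : |f x| ≤ C / |x| ^ p := by
  have hx0 : 0 < |x| := abs_pos.2 hx
  have hC0 : 0 ≤ C := (by positivity : 0 ≤ |f 0| * R ^ 2).trans (hC 0 (by simp; linarith))
  rcases le_or_gt |x| R with h | h
  · rw [le_div_iff₀ (Real.rpow_pos_of_pos hx0 p)]
    refine le_trans ?_ (hC x h)
    gcongr
    calc |x| ^ p ≤ R ^ p := Real.rpow_le_rpow hx0.le h hp0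
      _ ≤ R ^ (2 : ℝ) := Real.rpow_le_rpow_of_exponent_le hR hp2
      _ = R ^ 2 := Real.rpow_two R
  · refine (hA x h).trans ?_
    have : |x| ^ p ≤ |x| ^ 2 := by
      rw [← Real.rpow_two]
      exact Real.rpow_le_rpow_of_exponent_le (hR.trans h.le) hp2
    have hpos := Real.rpow_pos_of_pos hx0 p
    gcongr

namespace IsStationary

variable {J φ : ℝ → ℝ} {H : Set ℝ} {bp bm d a₀ a : ℝ}

theorem convolution_eq (hφ : IsStationary J H bp bm φ) {x : ℝ} (hx : x ∉ H) :
    convolution J φ (ContinuousLinearMap.mul ℝ ℝ) volume x = φ x :=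
  sub_eq_zero.1 (hφ.eq_outside x hx)

/-- The one-sided decay is applied to `φ` with slope `bp` and to its reflection with slope `bm`;
beyond `a₀` the smoothed profile is exactly linear on each side. -/
theorem exists_extension_deriv_decay (hφ : IsStationary J H bp bm φ) (hJ : IsKernel J d)
    (hH : IsHole H a₀ a) (hbp : 0 ≤ bp) (hbm : 0 ≤ bm) :
    ∃ A R, 1 ≤ R ∧ ∀ x, R < |x| →
      |deriv (fun y => convolution J φ (ContinuousLinearMap.mul ℝ ℝ) volume y -
        smoothProfile bp bm a₀ y) x| ≤ A / |x| ^ 2 ∧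
      |deriv (deriv fun y => convolution J φ (ContinuousLinearMap.mul ℝ ℝ) volume y -
        smoothProfile bp bm a₀ y) x| ≤ A / |x| ^ 2 := by
  set P := convolution J φ (ContinuousLinearMap.mul ℝ ℝ) volume
  obtain ⟨M, hM⟩ := hφ.bounded
  have ha : 0 < a := hH.a₀_pos.trans hH.a₀_lt_a
  obtain ⟨A, R, hR, hA, h⟩ := hJ.exists_deriv_decay hφ.locallyIntegrable (a := a) (b := bp)
    (M := M) (fun x hx => hφ.convolution_eq (hH.notMem_of_le_abs (hx.trans (le_abs_self x))))
    (fun x hx => by rw [← profile_of_nonneg hbp hbm (ha.le.trans hx)]; exact hM x)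
  obtain ⟨A', R', hR', hA', h'⟩ := hJ.exists_deriv_decay hφ.locallyIntegrable.comp_neg_real
    (a := a) (b := bm) (M := M)
    (fun x hx => by
      rw [convolution_comp_neg hJ.even]
      exact hφ.convolution_eq (hH.notMem_of_le_abs (by rw [abs_neg]; exact hx.trans (le_abs_self x))))
    (fun x hx => by
      have h1 := hM (-x)
      rw [profile_of_nonpos hbp hbm (by linarith)] at h1
      simpa using h1)
  have hrefl : (fun y => convolution J (fun z => φ (-z)) (ContinuousLinearMap.mul ℝ ℝ) volume y -
      bm * y) = fun y => (fun z => P z - -bm * z) (-y) := by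
    ext y
    rw [convolution_comp_neg hJ.even]
    simp [P]
  have hrefl' : deriv (fun y => (fun z => P z - -bm * z) (-y)) =
      fun y => -(deriv (fun z => P z - -bm * z) (-y)) := by
    ext y
    exact deriv_comp_neg (fun z => P z - -bm * z) y
  rw [hrefl, hrefl'] at h'
  refine ⟨A + A', R + R' + a₀, by linarith [hH.a₀_pos], fun x hx => ?_⟩
  have ha₀ := hH.a₀_pos
  rcases lt_abs.1 hx with hx1 | hx1
  · have hev : (fun y => P y - smoothProfile bp bm a₀ y) =ᶠ[𝓝 x] fun y => P y - bp * y := by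
      filter_upwards [lt_mem_nhds (show a₀ < x by linarith)] with y hy
      rw [smoothProfile_of_le ha₀ hy.le]
    rw [hev.deriv_eq, hev.deriv.deriv_eq, sq_abs]
    have hle : A / x ^ 2 ≤ (A + A') / x ^ 2 := by gcongr; linarith
    exact ⟨(h x (by linarith)).1.trans hle, (h x (by linarith)).2.trans hle⟩
  · have hev : (fun y => P y - smoothProfile bp bm a₀ y) =ᶠ[𝓝 x] fun y => P y - -bm * y := by
      filter_upwards [gt_mem_nhds (show x < -a₀ by linarith)] with y hy
      rw [smoothProfile_of_le_neg ha₀ hy.le]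
    rw [hev.deriv_eq, hev.deriv.deriv_eq, sq_abs]
    have hle : A' / x ^ 2 ≤ (A + A') / x ^ 2 := by gcongr; linarith
    have h2 := h' (-x) (by linarith)
    rw [deriv.fun_neg, deriv_comp_neg (deriv fun z => P z - -bm * z)] at h2
    simp only [neg_neg, abs_neg, neg_sq] at h2
    exact ⟨h2.1.trans hle, h2.2.trans hle⟩

end IsStationary

end NonlocalHole

/-- Derivatives on the closed set `ℝ \ H` are those of a `C²(ℝ)` function `Ψ` that coincides
with `ψ` there; at interior points of `ℝ \ H` they are the ordinary derivatives of `ψ`. -/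
theorem lemma2p4 (H : Set ℝ) (a₀ a : ℝ) (hH : NonlocalHole.IsHole H a₀ a)
    (J : ℝ → ℝ) (d : ℝ) (hJ : NonlocalHole.IsKernel J d)
    (bp bm : ℝ) (hbp : 0 ≤ bp) (hbm : 0 ≤ bm)
    (φ : ℝ → ℝ) (hφ : NonlocalHole.IsStationary J H bp bm φ)
    (ψ : ℝ → ℝ) (hψ : ψ = NonlocalHole.remainder bp bm φ) :
    ∃ C : ℝ, 0 < C ∧
      (∃ Ψ : ℝ → ℝ, ContDiff ℝ 2 Ψ ∧ Set.EqOn ψ Ψ Hᶜ ∧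
        ∀ x ∈ Hᶜ, |deriv Ψ x| ≤ C / |x| ^ (4 / 5 : ℝ) ∧
          |deriv (deriv Ψ) x| ≤ C / |x| ^ (5 / 3 : ℝ)) ∧
      (∀ x ∈ interior Hᶜ, ContDiffAt ℝ 2 ψ x ∧
        |deriv ψ x| ≤ C / |x| ^ (4 / 5 : ℝ) ∧
          |deriv (deriv ψ) x| ≤ C / |x| ^ (5 / 3 : ℝ)) := by
  obtain ⟨A, R, hR, hA⟩ := hφ.exists_extension_deriv_decay hJ hH hbp hbm
  -- The profile's corner at 0 is smoothed only inside `(-a₀, a₀)`, which lies in `H`, so agreement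
  -- with `ψ` off `H` is kept.
  set Ψ : ℝ → ℝ := fun y => MeasureTheory.convolution J φ (ContinuousLinearMap.mul ℝ ℝ)
    MeasureTheory.volume y - NonlocalHole.smoothProfile bp bm a₀ y
  have hΨ : ContDiff ℝ 2 Ψ := (hJ.contDiff_convolution hφ.locallyIntegrable).sub
    (NonlocalHole.contDiff_smoothProfile bp bm a₀)
  have hΨ' : ContDiff ℝ 1 (deriv Ψ) := by
    have : ContDiff ℝ (1 + 1) Ψ := by simpa [one_add_one_eq_two] using hΨ
    exact (contDiff_succ_iff_deriv.1 this).2.2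
  have heq : Set.EqOn ψ Ψ Hᶜ := fun x hx => by
    rw [hψ, NonlocalHole.remainder, NonlocalHole.profile_eq_smoothProfile hbp hbm hH.a₀_pos
      (hH.le_abs_of_notMem hx), ← hφ.convolution_eq hx]
  obtain ⟨M₁, hM₁⟩ := (isCompact_Icc (a := -R) (b := R)).exists_bound_of_continuousOn
    hΨ'.continuous.continuousOn
  obtain ⟨M₂, hM₂⟩ := (isCompact_Icc (a := -R) (b := R)).exists_bound_of_continuousOn
    (hΨ'.continuous_deriv le_rfl).continuousOn
  -- `|A|` serves `|x| > R`, the middle term serves `|x| ≤ R`, and the 1 gives positivity.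
  set C := |A| + (|M₁| + |M₂|) * R ^ 2 + 1
  have hAC : A ≤ C := by
    have : 0 ≤ (|M₁| + |M₂|) * R ^ 2 := by positivity
    linarith [le_abs_self A]
  have hbound : ∀ x ∈ Hᶜ, |deriv Ψ x| ≤ C / |x| ^ (4 / 5 : ℝ) ∧
      |deriv (deriv Ψ) x| ≤ C / |x| ^ (5 / 3 : ℝ) := fun x hx => by
    have hx0 : x ≠ 0 := abs_pos.1 (hH.a₀_pos.trans_le (hH.le_abs_of_notMem hx))
    refine ⟨NonlocalHole.le_div_rpow_of_decay hR (by norm_num) (by norm_num) hAC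
        (fun y hy => ?_) (fun y hy => (hA y hy).1) hx0,
      NonlocalHole.le_div_rpow_of_decay hR (by norm_num) (by norm_num) hAC
        (fun y hy => ?_) (fun y hy => (hA y hy).2) hx0⟩
    · have h1 : |deriv Ψ y| ≤ |M₁| + |M₂| :=
        (hM₁ y (abs_le.1 hy)).trans (by linarith [le_abs_self M₁, abs_nonneg M₂])
      have := mul_le_mul_of_nonneg_right h1 (sq_nonneg R)
      linarith [abs_nonneg A]
    · have h1 : |deriv (deriv Ψ) y| ≤ |M₁| + |M₂| :=
        (hM₂ y (abs_le.1 hy)).trans (by linarith [le_abs_self M₂, abs_nonneg M₁])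
      have := mul_le_mul_of_nonneg_right h1 (sq_nonneg R)
      linarith [abs_nonneg A]
  refine ⟨C, by positivity, ⟨Ψ, hΨ, heq, hbound⟩, fun x hx => ?_⟩
  have hev : ψ =ᶠ[nhds x] Ψ := Filter.eventuallyEq_of_mem (mem_interior_iff_mem_nhds.1 hx) heq
  rw [hev.deriv_eq, hev.deriv.deriv_eq]
  exact ⟨hΨ.contDiffAt.congr_of_eventuallyEq hev, hbound x (interior_subset hx)⟩
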